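/- Let $F$ be an algebraically closed field of characteristic zero and let $q\in F\setminus\{0\}$ be not a root of unity. Let $\tau_x,\tau_y$ be the automorphisms of the field $F(x,y)$ of rational functions given by $\tau_x(f(x,y))=f(qx,y)$ and $\tau_y(f(x,y))=f(x,qy)$. A rational function $f\in F(x,y)$ is called $(\tau_x,\tau_y)$-summable in $F(x,y)$ if $f=\tau_x(g)-g+\tau_y(h)-h$ for some $g,h\in F(x,y)$. For $r,s,t\in\mathbb N$ and $\sigma,\tau\in\{-1,1\}$, the $q$-analogue of Tornheim's double sum is the formal sum $$T[r,s,t;\sigma,\tau]=\sum_{n,m\ge 1}\frac{\sigma^n\tau^m q^{(r+t-1)n+(s+t-1)m}}{[n]_q^r\,[m]_q^s\,[n+m]_q^t},\qquad [n]_q=\sum_{j=0}^{n-1}q^j .$$ For every integer $t\ge 1$, put $$f=\frac{(xy)^{t-1}(q-1)^t}{(xy-1)^t}\in F(x,y).$$ Then for all integers $n,m\ge 1$ the rational function $f$ is defined at $(x,y)=(q^n,q^m)$ and its value there is the $(n,m)$-th summand of $T[0,0,t;1,1]$; and $f$ is not $(\tau_x,\tau_y)$-summable in $F(x,y)$. 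-/

import Mathlib

noncomputable section

namespace QTornheim

/-- The field `F(x, y)` of rational functions in two variables over `F`. -/
abbrev RatFunc2 (F : Type*) [Field F] : Type _ := FractionRing (MvPolynomial (Fin 2) F)

/-- The inclusion of constants `F → F(x, y)`. -/
abbrev const {F : Type*} [Field F] (c : F) : RatFunc2 F := algebraMap F (RatFunc2 F) c

/-- The variable `x` of `F(x, y)`. -/
abbrev x (F : Type*) [Field F] : RatFunc2 F :=
  algebraMap (MvPolynomial (Fin 2) F) (RatFunc2 F) (MvPolynomial.X 0)

/-- The variable `y` of `F(x, y)`. -/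
abbrev y (F : Type*) [Field F] : RatFunc2 F :=
  algebraMap (MvPolynomial (Fin 2) F) (RatFunc2 F) (MvPolynomial.X 1)

/-- The automorphism of `F[x, y]` with `x ↦ a x` and `y ↦ b y`, for nonzero `a` and `b`. -/
def scalePoly {F : Type*} [Field F] (a b : Fˣ) :
    MvPolynomial (Fin 2) F ≃ₐ[F] MvPolynomial (Fin 2) F :=
  AlgEquiv.ofAlgHom
    (MvPolynomial.aeval fun i => MvPolynomial.C (![(a : F), (b : F)] i) * MvPolynomial.X i)
    (MvPolynomial.aeval fun i =>
      MvPolynomial.C (![((a⁻¹ : Fˣ) : F), ((b⁻¹ : Fˣ) : F)] i) * MvPolynomial.X i)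
    (by
      ext1 i
      fin_cases i <;> simp [MvPolynomial.algHom_C, ← mul_assoc, ← MvPolynomial.C_mul])
    (by
      ext1 i
      fin_cases i <;> simp [MvPolynomial.algHom_C, ← mul_assoc, ← MvPolynomial.C_mul])

/-- The automorphism `f(x, y) ↦ f(a x, b y)` of `F(x, y)`, for nonzero `a` and `b`. -/
def scale {F : Type*} [Field F] (a b : Fˣ) : RatFunc2 F ≃+* RatFunc2 F :=
  IsFractionRing.ringEquivOfRingEquiv (scalePoly a b).toRingEquiv

/-- The `q`-shift operator `τ_x`, sending `f(x, y)` to `f(q x, y)`. -/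
def tauX {F : Type*} [Field F] (q : Fˣ) : RatFunc2 F ≃+* RatFunc2 F := scale q 1

/-- The `q`-shift operator `τ_y`, sending `f(x, y)` to `f(x, q y)`. -/
def tauY {F : Type*} [Field F] (q : Fˣ) : RatFunc2 F ≃+* RatFunc2 F := scale 1 q

/-- `f` is `(φ, ψ)`-summable in `K`: it is a sum of a `φ`-difference and a `ψ`-difference. -/
def IsSummable {K : Type*} [Field K] (φ ψ : K ≃+* K) (f : K) : Prop :=
  ∃ g h : K, f = φ g - g + (ψ h - h)

/-- The rational function `f` is defined at the point `(a, b)` and has the value `c` there. -/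
def HasValueAt {F : Type*} [Field F] (f : RatFunc2 F) (a b c : F) : Prop :=
  ∃ P Q : MvPolynomial (Fin 2) F,
    MvPolynomial.eval ![a, b] Q ≠ 0 ∧
    f = algebraMap _ (RatFunc2 F) P / algebraMap _ (RatFunc2 F) Q ∧
    c = MvPolynomial.eval ![a, b] P / MvPolynomial.eval ![a, b] Q

/-- The `q`-number `[n]_q = 1 + q + ⋯ + q ^ (n - 1)`. -/
def qNumber {F : Type*} [Field F] (q : F) (n : ℕ) : F := ∑ j ∈ Finset.range n, q ^ j

/-- The `(n, m)` term of the `q`-analogue `T[r, s, t; σ, τ]` of Tornheim's double sum, where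
`σ` and `τ` are signs. The exponents are integers, so that nothing is truncated. -/
def tornheimTerm {F : Type*} [Field F] (q : F) (r s t : ℕ) (σ τ : ℤˣ) (n m : ℕ) : F :=
  ((σ ^ n * τ ^ m : ℤˣ) : ℤ) *
      q ^ (((r : ℤ) + t - 1) * n + ((s : ℤ) + t - 1) * m) /
    (qNumber q n ^ r * qNumber q m ^ s * qNumber q (n + m) ^ t)

/-- The rational function `(x y) ^ (t - 1) (q - 1) ^ t / (x y - 1) ^ t`, for `t ≥ 1`. -/
def tornheimRat {F : Type*} [Field F] (q : F) (t : ℕ) : RatFunc2 F :=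
  (x F * y F) ^ (t - 1) * const (q - 1) ^ t / (x F * y F - 1) ^ t

end QTornheim

end

open Polynomial

/-! Since the function depends only on z = xy, take z and x as coordinates and expand in powers of x
with coefficients in F(z). Both shifts send z to qz; they differ only in rescaling x, which does not
affect the degree-0 coefficient. Comparing those coefficients turns summability into a one-variable
equation u(qz) - u(z) = c z^(t-1)/(z-1)^t with c ≠ 0 (`toLaurent_scale`, `toLaurent_tornheimRat`).
That equation has no rational solution (`qDifference_ne`): if u has poles on the orbit q^ℤ, its
extreme ones yield poles of u(qz) - u(z) at two distinct orbit points, and otherwise there are none,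
whereas the right side has exactly one, at z = 1. -/

theorem qDifference_ne {F : Type*} [Field F] (q : Fˣ) (hq : ∀ k : ℕ, 1 ≤ k → q ^ k ≠ 1) (t : ℕ) (ht : 1 ≤ t)
    (c : F) (hc : c ≠ 0) (P Q : F[X]) (hPQ : IsCoprime P Q) (hQ : Q ≠ 0) :
    (P.comp (C (q : F) * X) * Q - P * Q.comp (C (q : F) * X)) * (X - 1) ^ t ≠
      C c * X ^ (t - 1) * (Q * Q.comp (C (q : F) * X)) := by
  intro h
  have hinj : Function.Injective fun k : ℤ => ((q ^ k : Fˣ) : F) := by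
    have : ¬ IsOfFinOrder q := by
      rw [isOfFinOrder_iff_pow_eq_one]
      rintro ⟨k, hk, h1⟩
      exact hq k hk h1
    exact Units.val_injective.comp (injective_zpow_iff_not_isOfFinOrder.2 this)
  have hev : ∀ k : ℤ, (P.eval ((q ^ (k + 1) : Fˣ) : F) * Q.eval ((q ^ k : Fˣ) : F)
      - P.eval ((q ^ k : Fˣ) : F) * Q.eval ((q ^ (k + 1) : Fˣ) : F)) * (((q ^ k : Fˣ) : F) - 1) ^ t =
      c * ((q ^ k : Fˣ) : F) ^ (t - 1) *
        (Q.eval ((q ^ k : Fˣ) : F) * Q.eval ((q ^ (k + 1) : Fˣ) : F)) := by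
    intro k
    have := congrArg (eval ((q ^ k : Fˣ) : F)) h
    have e : ((q ^ (k + 1) : Fˣ) : F) = q * ((q ^ k : Fˣ) : F) := by
      rw [zpow_add_one, mul_comm, Units.val_mul]
    simpa [eval_comp, ← Units.val_zpow_eq_zpow_val, e] using this
  have hP : ∀ k : ℤ, Q.eval ((q ^ k : Fˣ) : F) = 0 → P.eval ((q ^ k : Fˣ) : F) ≠ 0 := by
    intro k hk hk'
    obtain ⟨a, b, hab⟩ := hPQ
    have := congrArg (eval ((q ^ k : Fˣ) : F)) hab
    rw [eval_add, eval_mul, eval_mul, hk, hk', eval_one] at this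
    simp at this
  have hone : ∀ k : ℤ, (((q ^ k : Fˣ) : F) - 1) ^ t = 0 → k = 0 := by
    intro k hk
    apply hinj
    simpa using sub_eq_zero.1 (pow_eq_zero_iff (by lia) |>.1 hk)
  set S : Set ℤ := {k | Q.eval ((q ^ k : Fˣ) : F) = 0} with hS
  have hfin : S.Finite := by
    refine Set.Finite.preimage (f := fun k : ℤ => ((q ^ k : Fˣ) : F)) hinj.injOn
      (s := {a | Q.IsRoot a}) ?_
    exact Polynomial.finite_setOfPred_isRoot hQ
  rcases S.eq_empty_or_nonempty with he | hne
  · have hz : ∀ k : ℤ, Q.eval ((q ^ k : Fˣ) : F) ≠ 0 := fun k hk => by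
      have : k ∈ S := hk
      simp [he] at this
    have h0 := hev 0
    -- No poles on the orbit: at z = 1 the left side vanishes because t ≥ 1, but the right side is c
    -- Q(1) Q(q).
    rw [zpow_zero, Units.val_one, sub_self, zero_pow (by lia), mul_zero, one_pow, mul_one,
      zero_add] at h0
    have h1 := hz 0
    rw [zpow_zero, Units.val_one] at h1
    exact mul_ne_zero hc (mul_ne_zero h1 (hz 1)) h0.symm
  · obtain ⟨m, hm, hmin⟩ := Set.exists_min_image S id hfin hne
    obtain ⟨M, hM, hmax⟩ := Set.exists_max_image S id hfin hne
    -- The lowest pole q^m of u gives u(qz) a pole at q^(m-1), where u has none to cancel it; so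
    -- q^(m-1) = 1.
    have h1 : m - 1 = 0 := by
      apply hone
      have hm0 : Q.eval ((q ^ m : Fˣ) : F) = 0 := hm
      have := hev (m - 1)
      rw [sub_add_cancel, hm0] at this
      have hn : Q.eval ((q ^ (m - 1) : Fˣ) : F) ≠ 0 := fun h' => by
        have := hmin _ h'
        simp at this
      simpa only [mul_zero, sub_zero, mul_eq_zero, hP m hm, hn, false_or] using this
    -- Likewise u has a pole at q^M but u(qz) does not, so q^M = 1. Then m = 1 > 0 = M.
    have h2 : M = 0 := by
      apply hone
      have hm0 : Q.eval ((q ^ M : Fˣ) : F) = 0 := hM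
      have := hev M
      rw [hm0] at this
      have hn : Q.eval ((q ^ (M + 1) : Fˣ) : F) ≠ 0 := fun h' => by
        have := hmax _ h'
        simp at this
      simpa only [mul_zero, zero_mul, zero_sub, neg_eq_zero, mul_eq_zero, hP M hM, hn,
        false_or] using this
    have := hmin M hM
    simp only [id] at this
    lia

/-- The ring endomorphism of `K((X))` acting on coefficients by `φ` and sending `X` to `w X`. -/
noncomputable def twist {K : Type*} [Field K] (φ : K ≃+* K) (w : Kˣ) : LaurentSeries K →+* LaurentSeries K where
  toFun f :=
    { coeff := fun n => ((w ^ n : Kˣ) : K) * φ (f.coeff n)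
      isPWO_support' := f.isPWO_support.mono fun n hn => by
        rw [HahnSeries.mem_support]
        intro h
        simp [h] at hn }
  map_zero' := by ext n; simp
  map_one' := by
    ext n
    by_cases h : n = 0 <;> simp [h, HahnSeries.coeff_one]
  map_add' f g := by ext n; simp [mul_add]
  map_mul' f g := by
    ext n
    simp only [HahnSeries.coeff_mul, map_sum, map_mul, Finset.mul_sum]
    -- Twisting preserves supports, so both convolutions run over the same index pairs.
    refine (Finset.sum_congr ?_ fun ij hij => ?_).trans rfl
    · ext ij
      simp [HahnSeries.mem_support, w.ne_zero, zpow_ne_zero]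
    · obtain ⟨-, -, h⟩ := Finset.mem_antidiagonal.1 hij
      rw [← h, zpow_add, Units.val_mul]
      ring

theorem coeff_twist {K : Type*} [Field K] (φ : K ≃+* K) (w : Kˣ) (f : LaurentSeries K) (n : ℤ) :
    (twist φ w f).coeff n = ((w ^ n : Kˣ) : K) * φ (f.coeff n) := rfl

theorem twist_single {K : Type*} [Field K] (φ : K ≃+* K) (w : Kˣ) (n : ℤ) (a : K) :
    twist φ w (HahnSeries.single n a) = HahnSeries.single n (((w ^ n : Kˣ) : K) * φ a) := by
  ext m
  rw [coeff_twist, HahnSeries.coeff_single, HahnSeries.coeff_single]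
  split_ifs with h
  · rw [h]
  · simp

/-- The automorphism `z ↦ q z` of `F[z]`. -/
noncomputable def polyScale {F : Type*} [Field F] (q : Fˣ) : F[X] ≃+* F[X] :=
  haveI : Invertible (q : F) := q.invertible
  (algEquivCMulXAddC (q : F) 0).toRingEquiv

theorem polyScale_apply {F : Type*} [Field F] (q : Fˣ) (P : F[X]) :
    polyScale q P = P.comp (C (q : F) * X) := by
  simp [polyScale, Polynomial.comp_eq_aeval]

/-- The automorphism `z ↦ q z` of `F(z)`. -/
noncomputable def fracScale {F : Type*} [Field F] (q : Fˣ) : FractionRing F[X] ≃+* FractionRing F[X] :=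
  IsFractionRing.ringEquivOfRingEquiv (polyScale q)

theorem fracScale_algebraMap {F : Type*} [Field F] (q : Fˣ) (P : F[X]) :
    fracScale q (algebraMap F[X] (FractionRing F[X]) P) =
      algebraMap F[X] (FractionRing F[X]) (P.comp (C (q : F) * X)) := by
  rw [fracScale, IsFractionRing.ringEquivOfRingEquiv_algebraMap, polyScale_apply]

/-- The embedding of `F[x, y]` in `F(z)((X))` given by `x ↦ X` and `y ↦ z X⁻¹`. -/
noncomputable def polyToLaurent (F : Type*) [Field F] :
    MvPolynomial (Fin 2) F →+* LaurentSeries (FractionRing F[X]) :=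
  MvPolynomial.eval₂Hom (HahnSeries.C.comp ((algebraMap F[X] (FractionRing F[X])).comp C))
    ![HahnSeries.single 1 1, HahnSeries.single (-1) (algebraMap F[X] (FractionRing F[X]) X)]

theorem polyToLaurent_apply {F : Type*} [Field F] (P : MvPolynomial (Fin 2) F) :
    polyToLaurent F P = ∑ d ∈ P.support, HahnSeries.single ((d 0 : ℤ) - d 1)
      (algebraMap F[X] (FractionRing F[X]) (monomial (d 1) (P.coeff d))) := by
  rw [polyToLaurent, MvPolynomial.coe_eval₂Hom, MvPolynomial.eval₂_eq']
  refine Finset.sum_congr rfl fun d _ => ?_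
  simp [Fin.prod_univ_two, HahnSeries.C_apply, HahnSeries.single_pow,
    HahnSeries.single_mul_single, ← C_mul_X_pow_eq_monomial, sub_eq_add_neg]

/-- The monomial x^a y^b goes to z^b X^(a-b), and (a-b, b) determines (a, b), so distinct monomials
cannot cancel. -/
theorem polyToLaurent_injective (F : Type*) [Field F] :
    Function.Injective (polyToLaurent F) := by
  rw [injective_iff_map_eq_zero]
  intro P hP
  ext d
  have h := congrArg (fun f => HahnSeries.coeff f ((d 0 : ℤ) - d 1)) hP
  simp only [polyToLaurent_apply, HahnSeries.coeff_sum, HahnSeries.coeff_single,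
    HahnSeries.coeff_zero] at h
  have h' : (∑ e ∈ P.support, if (d 0 : ℤ) - d 1 = (e 0 : ℤ) - e 1 then
      monomial (e 1) (P.coeff e) else 0) = (0 : F[X]) := by
    apply IsFractionRing.injective F[X] (FractionRing F[X])
    rw [map_sum, RingHom.map_zero, ← h]
    exact Finset.sum_congr rfl fun e _ => by split_ifs <;> simp
  have h2 := congrArg (fun p => Polynomial.coeff p (d 1)) h'
  simp only [Polynomial.finsetSum_coeff, Polynomial.coeff_zero] at h2
  rw [MvPolynomial.coeff_zero, ← h2, Finset.sum_eq_single d]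
  · simp
  · intro e _ hne
    split_ifs with h3
    · rw [Polynomial.coeff_monomial, if_neg]
      intro h4
      apply hne
      ext i
      fin_cases i
      · simp; lia
      · simpa using h4
    · simp
  · intro hd
    simp [MvPolynomial.notMem_support_iff.1 hd]

namespace QTornheim

/-- The embedding of `F(x, y)` in `F(z)((X))` given by `x ↦ X` and `y ↦ z X⁻¹`. -/
noncomputable def toLaurent (F : Type*) [Field F] : RatFunc2 F →+* LaurentSeries (FractionRing F[X]) :=
  IsFractionRing.lift (polyToLaurent_injective F)

theorem toLaurent_algebraMap {F : Type*} [Field F] (P : MvPolynomial (Fin 2) F) :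
    toLaurent F (algebraMap _ _ P) = polyToLaurent F P :=
  IsFractionRing.lift_algebraMap _ P

/-- Scaling multiplies z = xy by ab and X = x by a; it suffices to compare both sides on constants,
x and y. -/
theorem toLaurent_scale {F : Type*} [Field F] (a b : Fˣ) (f : RatFunc2 F) :
    toLaurent F (scale a b f) =
      twist (fracScale (a * b))
        (Units.map ((algebraMap F[X] (FractionRing F[X])).comp C).toMonoidHom a)
        (toLaurent F f) := by
  refine RingHom.congr_fun (f := (toLaurent F).comp (scale a b).toRingHom)
    (g := (twist _ _).comp (toLaurent F)) ?_ f
  refine IsFractionRing.ringHom_ext (A := MvPolynomial (Fin 2) F) fun P => ?_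
  simp only [RingHom.comp_apply, toLaurent_algebraMap]
  have h1 : (scale a b).toRingHom (algebraMap (MvPolynomial (Fin 2) F) (RatFunc2 F) P) =
      algebraMap _ _ (scalePoly a b P) :=
    IsFractionRing.ringEquivOfRingEquiv_algebraMap (scalePoly a b).toRingEquiv P
  rw [h1, toLaurent_algebraMap]
  refine RingHom.congr_fun (f := (polyToLaurent F).comp (scalePoly a b).toRingEquiv.toRingHom)
    (g := (twist _ _).comp (polyToLaurent F)) ?_ P
  refine MvPolynomial.ringHom_ext (fun c => ?_) fun i => ?_
  · simp [polyToLaurent, scalePoly, MvPolynomial.algHom_C, HahnSeries.C_apply, twist_single,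
      fracScale_algebraMap]
  · fin_cases i
    · simp [polyToLaurent, scalePoly, HahnSeries.C_apply, twist_single,
        HahnSeries.single_mul_single]
    · simp [polyToLaurent, scalePoly, HahnSeries.C_apply, twist_single, fracScale_algebraMap,
        HahnSeries.single_mul_single]
      have ha : algebraMap F[X] (FractionRing F[X]) (C (a : F)) ≠ 0 := by simp
      rw [mul_assoc, inv_mul_cancel_left₀ ha]

theorem toLaurent_tornheimRat {F : Type*} [Field F] (q : F) (t : ℕ) :
    toLaurent F (tornheimRat q t) = HahnSeries.C
      (algebraMap F[X] (FractionRing F[X]) (C ((q - 1) ^ t) * X ^ (t - 1)) /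
        algebraMap F[X] (FractionRing F[X]) ((X - 1) ^ t)) := by
  have hxy : toLaurent F (x F * y F) = HahnSeries.C (algebraMap F[X] (FractionRing F[X]) X) := by
    rw [map_mul, toLaurent_algebraMap, toLaurent_algebraMap]
    simp [polyToLaurent, HahnSeries.C_apply, HahnSeries.single_mul_single]
  have hc (c : F) : toLaurent F (const c) =
      HahnSeries.C (algebraMap F[X] (FractionRing F[X]) (C c)) := by
    rw [const, IsScalarTower.algebraMap_apply F (MvPolynomial (Fin 2) F) (RatFunc2 F),
      toLaurent_algebraMap]
    simp [polyToLaurent, MvPolynomial.algebraMap_eq]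
  rw [tornheimRat, map_div₀, map_mul, map_pow, map_pow, map_pow, map_sub, hxy, hc, map_one,
    map_div₀]
  simp only [map_mul, map_pow, map_sub, map_one]
  ring

/-- No rational function `u` of `z` satisfies `u(q z) - u(z) = c z ^ (t - 1) / (z - 1) ^ t`. -/
theorem fracScale_sub_ne {F : Type*} [Field F] (q : Fˣ) (hq : ∀ k : ℕ, 1 ≤ k → q ^ k ≠ 1)
    (t : ℕ) (ht : 1 ≤ t) (c : F) (hc : c ≠ 0) (u : FractionRing F[X]) :
    algebraMap F[X] (FractionRing F[X]) (C c * X ^ (t - 1)) /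
        algebraMap F[X] (FractionRing F[X]) ((X - 1) ^ t) ≠ fracScale q u - u := by
  intro h
  obtain ⟨P, Q, hPQ, rfl⟩ := IsFractionRing.exists_reduced_fraction (A := F[X]) u
  have hQ : (Q : F[X]) ≠ 0 := nonZeroDivisors.ne_zero Q.2
  apply qDifference_ne q hq t ht c hc P Q hPQ.isCoprime hQ
  have hinj := IsFractionRing.injective F[X] (FractionRing F[X])
  have hX : ((X : F[X]) - 1) ^ t ≠ 0 := pow_ne_zero _ (X_sub_C_ne_zero (1 : F))
  have hQ' : (Q : F[X]).comp (C (q : F) * X) ≠ 0 := by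
    rw [← polyScale_apply]
    exact (map_ne_zero_iff _ (polyScale q).injective).2 hQ
  rw [IsFractionRing.mk'_eq_div, map_div₀, fracScale_algebraMap, fracScale_algebraMap] at h
  have := (map_ne_zero_iff _ hinj).2 hX
  have := (map_ne_zero_iff _ hinj).2 hQ
  have := (map_ne_zero_iff _ hinj).2 hQ'
  apply hinj
  rw [div_sub_div _ _ ‹_› ‹_›, div_eq_div_iff ‹_› (mul_ne_zero ‹_› ‹_›)] at h
  simp only [map_mul, map_sub] at h ⊢
  linear_combination -h

theorem not_isSummable_tornheimRat {F : Type*} [Field F]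
    (q : Fˣ) (hq : ∀ k : ℕ, 1 ≤ k → q ^ k ≠ 1) (t : ℕ) (ht : 1 ≤ t) :
    ¬ IsSummable (tauX q) (tauY q) (tornheimRat (q : F) t) := by
  rintro ⟨g, h, H⟩
  have hq1 : ((q : F) - 1) ^ t ≠ 0 :=
    pow_ne_zero _ (sub_ne_zero.2 fun e => hq 1 le_rfl (by ext; simpa using e))
  refine fracScale_sub_ne q hq t ht _ hq1
    ((toLaurent F g).coeff 0 + (toLaurent F h).coeff 0) ?_
  -- In degree 0 the factor w^0 is 1, so both shifts act on the coefficient as z ↦ qz.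
  have := congrArg (fun f => (toLaurent F f).coeff 0) H
  simp only [toLaurent_tornheimRat, map_add, map_sub, tauX, tauY, toLaurent_scale,
    HahnSeries.coeff_add, HahnSeries.coeff_sub, coeff_twist, HahnSeries.C_apply,
    HahnSeries.coeff_single_same, zpow_zero, Units.val_one, one_mul, mul_one] at this
  rw [this, map_add]
  ring

theorem hasValueAt_tornheimRat {F : Type*} [Field F]
    (q : Fˣ) (hq : ∀ k : ℕ, 1 ≤ k → q ^ k ≠ 1) (t : ℕ) (ht : 1 ≤ t) (n m : ℕ) (hn : 1 ≤ n) :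
    HasValueAt (tornheimRat (q : F) t) ((q : F) ^ n) ((q : F) ^ m)
      (tornheimTerm (q : F) 0 0 t 1 1 n m) := by
  have hpow (k : ℕ) (hk : 1 ≤ k) : (q : F) ^ k - 1 ≠ 0 :=
    sub_ne_zero.2 fun e => hq k hk (by ext; simpa using e)
  have hq1 : (q : F) - 1 ≠ 0 := by simpa using hpow 1 le_rfl
  have hnm := hpow (n + m) (by lia)
  refine ⟨(MvPolynomial.X 0 * MvPolynomial.X 1) ^ (t - 1) * MvPolynomial.C ((q : F) - 1) ^ t,
    (MvPolynomial.X 0 * MvPolynomial.X 1 - 1) ^ t, ?_, ?_, ?_⟩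
  · simpa [← pow_add] using fun h => absurd h hnm
  · simp only [tornheimRat, map_mul, map_pow, map_sub, map_one, const]
    rw [IsScalarTower.algebraMap_apply F (MvPolynomial (Fin 2) F) (RatFunc2 F),
      MvPolynomial.algebraMap_eq]
  -- As t ≥ 1, the integer exponent of q is the natural number (n+m)(t-1), matching (xy)^(t-1) at
  -- the point.
  · have he : (((0 : ℕ) : ℤ) + t - 1) * n + (((0 : ℕ) : ℤ) + t - 1) * m =
        (((n + m) * (t - 1) : ℕ) : ℤ) := by
      push_cast [Nat.cast_sub ht]
      ring
    rw [tornheimTerm, he, zpow_natCast, qNumber.eq_def _ (n + m),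
      geom_sum_eq (sub_ne_zero.1 hq1)]
    simp [← pow_add, ← pow_mul, div_pow, div_div_eq_mul_div]

end QTornheim

theorem mainTheorem10 {F : Type*} [Field F] [IsAlgClosed F] [CharZero F]
    (q : Fˣ) (hq : ∀ k : ℕ, 1 ≤ k → q ^ k ≠ 1) (t : ℕ) (ht : 1 ≤ t) :
    (∀ n m : ℕ, 1 ≤ n → 1 ≤ m →
      QTornheim.HasValueAt (QTornheim.tornheimRat (q : F) t) ((q : F) ^ n) ((q : F) ^ m)
        (QTornheim.tornheimTerm (q : F) 0 0 t 1 1 n m)) ∧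
    ¬ QTornheim.IsSummable (QTornheim.tauX q) (QTornheim.tauY q)
        (QTornheim.tornheimRat (q : F) t) := by
  exact ⟨fun n m hn _ => QTornheim.hasValueAt_tornheimRat q hq t ht n m hn,
    QTornheim.not_isSummable_tornheimRat q hq t ht⟩
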